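/- All graphs are finite and simple. For a connected graph $G$, a sequence $(x_1,\dots,x_k)$ of vertices is a burning sequence of length $k$ if the following process burns all vertices of $G$ in exactly $k$ rounds: initially no vertex is burned; in round $r\ge 1$, the vertex $x_r$, which must be unburned at the beginning of round $r$, becomes burned, together with every vertex adjacent to a vertex that was burned before round $r$; burned vertices remain burned. The burning number $b(G)$ is the minimum length of a burning sequence for $G$. Let $T$ be a tree of order $n$ with at most $\lfloor\sqrt{n-1}\rfloor$ vertices of degree $2$. Then $b(T)\le\lceil\sqrt n\,\rceil$. -/

import Mathlib

namespace SimpleGraph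

/-- The set of vertices of `G` that are burned after the first `r` rounds when the entries of `s`
are used, in order, as sources (`s[r]?` is the source of round `r + 1`). In each round the source
of the round and all neighbours of already burned vertices are burned; burned vertices stay
burned. -/
def burnedAfter {V : Type*} (G : SimpleGraph V) (s : List V) : ℕ → Set V
  | 0 => ∅
  | r + 1 => G.burnedAfter s r ∪ {v | s[r]? = some v} ∪ {v | ∃ u ∈ G.burnedAfter s r, G.Adj u v}

/-- `s = (x₁, …, x_k)` is a burning sequence for `G`: each source is unburned at the beginning of
its round, and all vertices are burned after round `k`. (As `x_k` is unburned before round `k`,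
the process does not terminate in an earlier round.) -/
structure IsBurningSequence {V : Type*} (G : SimpleGraph V) (s : List V) : Prop where
  source_unburned : ∀ (r : ℕ) (hr : r < s.length), s[r] ∉ G.burnedAfter s r
  all_burned : G.burnedAfter s s.length = Set.univ

/-- The burning number of `G`: the minimum length of a burning sequence for `G`
(it is `⊤` if there is no burning sequence). -/
noncomputable def burningNumber {V : Type*} (G : SimpleGraph V) : ℕ∞ :=
  ⨅ (s : List V) (_ : G.IsBurningSequence s), (s.length : ℕ∞)

end SimpleGraph

namespace SimpleGraph

/-! ### From burning sequences to coverings by balls -/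

section Burning

variable {V : Type*} (G : SimpleGraph V)

/-! A covering by balls of radii `0, …, m - 1` yields a burning sequence. Every leaf is adjacent to
an internal vertex (when one exists), so it suffices to cover the internal vertices with all radii
reduced by one. Degree counting bounds their number by half of `n + n₂`, where `n₂` counts vertices
of degree `2`, and here `n + n₂ < m (m + 1)`. The covering is greedy
(`IsParentClosed.exists_cover`): in a rooted tree, the ancestor `j` steps above a deepest vertex has
at least `j + 1` descendants, all within distance `j`. -/

theorem burnedAfter_subset_succ (s : List V) (r : ℕ) :
    G.burnedAfter s r ⊆ G.burnedAfter s (r + 1) :=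
  fun _ hx => Or.inl (Or.inl hx)

theorem burnedAfter_mono (s : List V) : Monotone (G.burnedAfter s) :=
  monotone_nat_of_le_succ (G.burnedAfter_subset_succ s)

theorem burnedAfter_append (s t : List V) {r : ℕ} (hr : r ≤ s.length) :
    G.burnedAfter (s ++ t) r = G.burnedAfter s r := by
  induction r with
  | zero => rfl
  | succ r ih =>
    simp only [burnedAfter, ih (Nat.le_of_succ_le hr), List.getElem?_append_left hr]

theorem Walk.mem_burnedAfter {G : SimpleGraph V} {s : List V} {u v : V} (p : G.Walk u v) :
    ∀ {a : ℕ}, u ∈ G.burnedAfter s a → v ∈ G.burnedAfter s (a + p.length) := by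
  induction p with
  | nil => exact fun h => h
  | cons h p ih =>
    intro a ha
    have := ih (a := a + 1) (Or.inr ⟨_, ha, h⟩)
    rwa [Walk.length_cons, Nat.add_comm p.length, ← Nat.add_assoc]

theorem mem_burnedAfter_of_dist_le {G : SimpleGraph V} (hG : G.Connected) {s : List V} {u v : V}
    {a b : ℕ} (hu : u ∈ G.burnedAfter s a) (h : a + G.dist u v ≤ b) : v ∈ G.burnedAfter s b := by
  obtain ⟨p, hp⟩ := hG.exists_walk_length_eq_dist u v
  exact G.burnedAfter_mono s (hp ▸ h) (p.mem_burnedAfter hu)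

/-- Prescribed sources can be followed as long as unburned vertices remain: a source that is
already burned is replaced by an arbitrary unburned vertex. -/
theorem exists_sources_unburned (t : ℕ → V) (m : ℕ) :
    (∃ s : List V, s.length ≤ m ∧ G.IsBurningSequence s) ∨
    ∃ s : List V, s.length = m ∧ (∀ (r : ℕ) (hr : r < s.length), s[r] ∉ G.burnedAfter s r) ∧
      ∀ i < m, t i ∈ G.burnedAfter s (i + 1) := by
  induction m with
  | zero => exact Or.inr ⟨[], rfl, by simp, by simp⟩
  | succ m ih =>
    rcases ih with ⟨s, hs, hb⟩ | ⟨s, hs, hun, ht⟩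
    · exact Or.inl ⟨s, by omega, hb⟩
    by_cases hall : G.burnedAfter s s.length = Set.univ
    · exact Or.inl ⟨s, by omega, hun, hall⟩
    obtain ⟨x, hx, hxt⟩ : ∃ x, x ∉ G.burnedAfter s m ∧ (t m ∉ G.burnedAfter s m → x = t m) := by
      by_cases h : t m ∈ G.burnedAfter s m
      · obtain ⟨x, hx⟩ := (Set.ne_univ_iff_exists_notMem _).1 hall
        exact ⟨x, hs ▸ hx, fun h' => absurd h h'⟩
      · exact ⟨t m, h, fun _ => rfl⟩
    refine Or.inr ⟨s ++ [x], by simp [hs], fun r hr => ?_, fun i hi => ?_⟩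
    · rw [List.length_append, List.length_singleton] at hr
      rw [G.burnedAfter_append _ _ (Nat.le_of_lt_succ hr)]
      rcases Nat.lt_succ_iff_lt_or_eq.1 hr with h | h
      · rw [List.getElem_append_left h]
        exact hun r h
      · subst h
        rw [List.getElem_concat_length rfl, hs]
        exact hx
    · rcases Nat.lt_succ_iff_lt_or_eq.1 hi with h | h
      · rw [G.burnedAfter_append _ _ (by omega)]
        exact ht i h
      · subst h
        by_cases h : t i ∈ G.burnedAfter s i
        · refine G.burnedAfter_subset_succ _ _ ?_
          rwa [G.burnedAfter_append _ _ hs.ge]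
        · refine Or.inl (Or.inr ?_)
          rw [← hxt h, ← hs]
          simp

/-- A covering by balls of radii `0, …, m - 1` bounds the burning number by `m`. -/
theorem burningNumber_le_of_cover {G : SimpleGraph V} (hG : G.Connected) (c : ℕ → V) (m : ℕ)
    (hc : ∀ x, ∃ i < m, G.dist (c i) x ≤ i) : G.burningNumber ≤ m := by
  obtain ⟨s, hs, hb⟩ : ∃ s : List V, s.length ≤ m ∧ G.IsBurningSequence s := by
    -- Larger radii come first: the earliest source has the most rounds left to spread.
    rcases G.exists_sources_unburned (fun i => c (m - 1 - i)) m with h | ⟨s, hs, hun, ht⟩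
    · exact h
    refine ⟨s, hs.le, hun, Set.eq_univ_of_forall fun x => ?_⟩
    obtain ⟨i, hi, hx⟩ := hc x
    have h := ht (m - 1 - i) (by omega)
    rw [show m - 1 - (m - 1 - i) = i by omega] at h
    exact mem_burnedAfter_of_dist_le hG h (by omega)
  exact (iInf₂_le s hb).trans (by exact_mod_cast hs)

end Burning

/-! ### Covering parent-closed sets by balls -/

section Cover

variable {V : Type*} {G : SimpleGraph V}

/-- A parent function of a graph rooted at `ρ`: every vertex other than `ρ` has a neighbour that
is one step closer to `ρ`. -/
def IsParent (G : SimpleGraph V) (ρ : V) (par : V → V) : Prop :=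
  ∀ x, x ≠ ρ → G.Adj x (par x) ∧ G.dist ρ x = G.dist ρ (par x) + 1

theorem Connected.exists_isParent (hG : G.Connected) (ρ : V) : ∃ par, G.IsParent ρ par := by
  have : ∀ x, ∃ y, x ≠ ρ → G.Adj x y ∧ G.dist ρ x = G.dist ρ y + 1 := fun x => by
    by_cases hx : x = ρ
    · exact ⟨x, fun h => absurd hx h⟩
    obtain ⟨p, hp⟩ := hG.exists_walk_length_eq_dist x ρ
    cases p with
    | nil => exact absurd rfl hx
    | @cons _ y _ h p =>
      refine ⟨y, fun _ => ⟨h, ?_⟩⟩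
      have h1 := dist_le p
      have h2 := hG.dist_triangle (u := x) (v := y) (w := ρ)
      rw [dist_eq_one_iff_adj.2 h] at h2
      rw [Walk.length_cons] at hp
      rw [dist_comm, dist_comm (u := ρ)]
      omega
  choose par hpar using this
  exact ⟨par, hpar⟩

/-- A set of vertices closed under taking parents. -/
def IsParentClosed (ρ : V) (par : V → V) (S : Finset V) : Prop :=
  ∀ x ∈ S, x ≠ ρ → par x ∈ S

open Classical in
/-- The descendants of `v` in `S`. -/
noncomputable def descendants (ρ : V) (par : V → V) (S : Finset V) (v : V) : Finset V :=
  S.filter fun x => ∃ i, par^[i] x = v ∧ ∀ j < i, par^[j] x ≠ ρ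

variable {ρ : V} {par : V → V} {S : Finset V}

theorem mem_descendants {v x : V} : x ∈ descendants ρ par S v ↔
    x ∈ S ∧ ∃ i, par^[i] x = v ∧ ∀ j < i, par^[j] x ≠ ρ := by
  simp [descendants]

theorem IsParent.dist_iterate (hp : G.IsParent ρ par) {x : V} {i : ℕ}
    (h : ∀ j < i, par^[j] x ≠ ρ) : G.dist ρ x = G.dist ρ (par^[i] x) + i := by
  induction i with
  | zero => rfl
  | succ i ih =>
    rw [ih fun j hj => h j (by omega), Function.iterate_succ_apply',
      (hp _ (h i (by omega))).2]
    omega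

theorem IsParent.iterate_ne (hp : G.IsParent ρ par) {x : V} {i : ℕ} (h : i ≤ G.dist ρ x) :
    ∀ j < i, par^[j] x ≠ ρ := by
  intro j
  induction j using Nat.strong_induction_on with
  | _ j ih =>
    intro hj he
    have := hp.dist_iterate (x := x) (i := j) fun l hl => ih l hl (hl.trans hj)
    rw [he, dist_self] at this
    omega

theorem IsParent.dist_iterate_le (hG : G.Connected) (hp : G.IsParent ρ par) {x : V} {i : ℕ}
    (h : ∀ j < i, par^[j] x ≠ ρ) : G.dist (par^[i] x) x ≤ i := by
  induction i with
  | zero => simp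
  | succ i ih =>
    have h1 := ih fun j hj => h j (by omega)
    have h2 := dist_eq_one_iff_adj.2 (hp _ (h i (by omega))).1.symm
    have h3 := hG.dist_triangle (u := par^[i + 1] x) (v := par^[i] x) (w := x)
    rw [Function.iterate_succ_apply'] at h3 ⊢
    omega

theorem IsParentClosed.iterate_mem (hS : IsParentClosed ρ par S) {x : V} (hx : x ∈ S) {i : ℕ}
    (h : ∀ j < i, par^[j] x ≠ ρ) : par^[i] x ∈ S := by
  induction i with
  | zero => exact hx
  | succ i ih =>
    rw [Function.iterate_succ_apply']
    exact hS _ (ih fun j hj => h j (by omega)) (h i (by omega))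

open Classical in
theorem IsParentClosed.sdiff_descendants (hS : IsParentClosed ρ par S) (v : V) :
    IsParentClosed ρ par (S \ descendants ρ par S v) := by
  intro x hx hxρ
  rw [Finset.mem_sdiff] at hx ⊢
  refine ⟨hS x hx.1 hxρ, fun h => hx.2 ?_⟩
  obtain ⟨i, hi, hj⟩ := (mem_descendants.1 h).2
  refine mem_descendants.2 ⟨hx.1, i + 1, hi, fun j hji => ?_⟩
  cases j with
  | zero => exact hxρ
  | succ j => exact hj j (by omega)

theorem self_mem_descendants {v : V} (hv : v ∈ S) : v ∈ descendants ρ par S v :=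
  mem_descendants.2 ⟨hv, 0, rfl, by simp⟩

open Classical in
/-- Two vertices of a parent-closed set are joined by a path inside the set. -/
theorem IsParentClosed.dist_lt_card (hG : G.Connected) (hp : G.IsParent ρ par) (N : ℕ) :
    ∀ (S : Finset V), IsParentClosed ρ par S → ∀ u ∈ S, ∀ w ∈ S,
      G.dist ρ u + G.dist ρ w ≤ N → G.dist u w < S.card := by
  induction N with
  | zero =>
    intro S _ u hu w _ h
    have h1 := hG.dist_triangle (u := u) (v := ρ) (w := w)
    rw [dist_comm (u := u) (v := ρ)] at h1
    have := Finset.card_pos.2 ⟨u, hu⟩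
    omega
  | succ N ih =>
    intro S hS
    have key : ∀ u ∈ S, ∀ w ∈ S, G.dist ρ u + G.dist ρ w ≤ N + 1 →
        G.dist ρ w ≤ G.dist ρ u → G.dist u w < S.card := by
      intro u hu w hw h hle
      by_cases huw : u = w
      · rw [huw, dist_self]
        exact Finset.card_pos.2 ⟨u, hu⟩
      have huρ : u ≠ ρ := by
        rintro rfl
        rw [dist_self, Nat.le_zero, hG.dist_eq_zero_iff] at hle
        exact huw hle
      have hnot : ∀ z, G.dist ρ z ≤ G.dist ρ u → z ≠ u → z ∉ descendants ρ par S u := by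
        intro z hz hzu hm
        obtain ⟨i, hi, hj⟩ := (mem_descendants.1 hm).2
        have := hp.dist_iterate hj
        rw [hi] at this
        obtain rfl : i = 0 := by omega
        exact hzu hi
      -- Delete the deeper endpoint with its descendants and continue from its parent: one step of
      -- distance costs at least one vertex.
      have hpu := hp u huρ
      have h1 := ih _ (hS.sdiff_descendants u) (par u)
        (Finset.mem_sdiff.2 ⟨hS u hu huρ, hnot _ (by omega) hpu.1.ne'⟩) w
        (Finset.mem_sdiff.2 ⟨hw, hnot _ hle (Ne.symm huw)⟩) (by omega)
      have h2 := Finset.card_lt_card (Finset.ssubset_iff_subset_ne.2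
        ⟨Finset.sdiff_subset (s := S) (t := descendants ρ par S u), fun he => by
          have := he ▸ hu
          exact (Finset.mem_sdiff.1 this).2 (self_mem_descendants hu)⟩)
      have h3 := hG.dist_triangle (u := u) (v := par u) (w := w)
      rw [dist_eq_one_iff_adj.2 hpu.1] at h3
      omega
    intro u hu w hw h
    rcases le_total (G.dist ρ w) (G.dist ρ u) with hle | hle
    · exact key u hu w hw h hle
    · rw [dist_comm]
      exact key w hw u hu (by omega) hle

/-- A parent-closed set lies in a ball of radius `r` about the root, or it contains a vertex with
at least `r + 1` descendants, all of them at distance at most `r`. -/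
theorem IsParentClosed.exists_descendants (hG : G.Connected) (hp : G.IsParent ρ par)
    (hS : IsParentClosed ρ par S) (r : ℕ) :
    (∀ x ∈ S, G.dist ρ x ≤ r) ∨ ∃ v ∈ S, r + 1 ≤ (descendants ρ par S v).card ∧
      ∀ x ∈ descendants ρ par S v, G.dist v x ≤ r := by
  by_cases hr : ∀ x ∈ S, G.dist ρ x ≤ r
  · exact Or.inl hr
  push Not at hr
  obtain ⟨z, hz, hrz⟩ := hr
  obtain ⟨x, hx, hmax⟩ := S.exists_max_image (G.dist ρ) ⟨z, hz⟩
  have hrx : r ≤ G.dist ρ x := hrz.le.trans (hmax z hz)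
  have hne := hp.iterate_ne hrx
  have hd : ∀ i ≤ r, G.dist ρ x = G.dist ρ (par^[i] x) + i := fun i hi =>
    hp.dist_iterate fun j hj => hne j (by omega)
  refine Or.inr ⟨par^[r] x, hS.iterate_mem hx hne, ?_, fun y hy => ?_⟩
  · rw [← Finset.card_range (r + 1)]
    refine Finset.card_le_card_of_injOn (fun i => par^[i] x) (fun i hi => ?_) ?_
    · have hi : i ≤ r := by simpa [Nat.lt_succ_iff] using hi
      refine Finset.mem_coe.2 (mem_descendants.2
        ⟨hS.iterate_mem hx fun j hj => hne j (by omega), r - i, ?_, fun j hj => ?_⟩)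
      · rw [← Function.iterate_add_apply, Nat.sub_add_cancel hi]
      · rw [← Function.iterate_add_apply]
        exact hne _ (by omega)
    · intro i hi j hj hij
      have hi : i ≤ r := by simpa [Nat.lt_succ_iff] using hi
      have hj : j ≤ r := by simpa [Nat.lt_succ_iff] using hj
      have h1 := hd i hi
      have h2 := hd j hj
      have h3 : par^[i] x = par^[j] x := hij
      rw [h3] at h1
      omega
  · obtain ⟨hyS, i, hi, hj⟩ := mem_descendants.1 hy
    have h1 := hp.dist_iterate hj
    have h2 := hd r le_rfl
    have h3 := hmax y hyS
    have h4 := hp.dist_iterate_le hG hj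
    rw [hi] at h1 h4
    omega

open Classical in
-- If `v` has at least `r + 1` descendants, all within `r`, then `v` and its non-descendants form a
-- parent-closed set of at most `r + 1` vertices, so distances there are also at most `r`.
theorem IsParentClosed.exists_ball (hG : G.Connected) (hp : G.IsParent ρ par)
    (hS : IsParentClosed ρ par S) (r : ℕ) (hcard : S.card ≤ 2 * r + 1) :
    ∃ v, ∀ x ∈ S, G.dist v x ≤ r := by
  rcases hS.exists_descendants hG hp r with h | ⟨v, hv, hc, hd⟩
  · exact ⟨ρ, h⟩
  refine ⟨v, fun y hy => ?_⟩
  by_cases hyd : y ∈ descendants ρ par S v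
  · exact hd y hyd
  have hR : IsParentClosed ρ par (insert v (S \ descendants ρ par S v)) := by
    intro x hx hxρ
    rcases Finset.mem_insert.1 hx with rfl | hx
    · refine Finset.mem_insert_of_mem (Finset.mem_sdiff.2 ⟨hS x hv hxρ, fun hm => ?_⟩)
      obtain ⟨i, hi, hj⟩ := (mem_descendants.1 hm).2
      have h1 := hp.dist_iterate hj
      have h2 := (hp x hxρ).2
      rw [hi] at h1
      omega
    · exact Finset.mem_insert_of_mem (hS.sdiff_descendants v x hx hxρ)
  have h1 := IsParentClosed.dist_lt_card hG hp _ _ hR v (Finset.mem_insert_self _ _) y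
    (Finset.mem_insert_of_mem (Finset.mem_sdiff.2 ⟨hy, hyd⟩)) le_rfl
  have h2 := Finset.card_insert_le v (S \ descendants ρ par S v)
  have h3 := Finset.card_sdiff_add_card_eq_card
    (show descendants ρ par S v ⊆ S from fun x hx => (mem_descendants.1 hx).1)
  omega

open Classical in
-- The balls of radii `j - 1, …, 0` remove at least `j + … + 1` vertices; the extra ball of radius
-- `R` takes the last `2R + 1`.
theorem IsParentClosed.exists_cover (hG : G.Connected) (hp : G.IsParent ρ par) (R j : ℕ) :
    ∀ S : Finset V, IsParentClosed ρ par S → 2 * S.card ≤ j * (j + 1) + 2 * (2 * R + 1) →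
      ∃ (v : V) (c : ℕ → V), ∀ x ∈ S, G.dist v x ≤ R ∨ ∃ i < j, G.dist (c i) x ≤ i := by
  induction j with
  | zero =>
    intro S hS h
    obtain ⟨v, hv⟩ := hS.exists_ball hG hp R (by omega)
    exact ⟨v, fun _ => ρ, fun x hx => Or.inl (hv x hx)⟩
  | succ j ih =>
    intro S hS h
    rcases hS.exists_descendants hG hp j with hr | ⟨w, hw, hc, hd⟩
    · exact ⟨ρ, fun _ => ρ, fun x hx => Or.inr ⟨j, by omega, hr x hx⟩⟩
    have h3 := Finset.card_sdiff_add_card_eq_card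
      (show descendants ρ par S w ⊆ S from fun x hx => (mem_descendants.1 hx).1)
    obtain ⟨v, c, hvc⟩ := ih _ (hS.sdiff_descendants w) (by nlinarith)
    refine ⟨v, Function.update c j w, fun x hx => ?_⟩
    by_cases hxd : x ∈ descendants ρ par S w
    · exact Or.inr ⟨j, by omega, by simpa using hd x hxd⟩
    · rcases hvc x (Finset.mem_sdiff.2 ⟨hx, hxd⟩) with h | ⟨i, hi, hxi⟩
      · exact Or.inl h
      · refine Or.inr ⟨i, by omega, ?_⟩
        rwa [Function.update_of_ne (by omega)]

end Cover

/-! ### Internal vertices of a tree -/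

section Tree

variable {V : Type*} [Fintype V] {T : SimpleGraph V} [DecidableRel T.Adj]

theorem IsTree.two_mul_card_two_le_degree_add_two_le (hT : T.IsTree) [Nontrivial V] :
    2 * (Finset.univ.filter fun v : V => 2 ≤ T.degree v).card + 2 ≤
      Fintype.card V + (Finset.univ.filter fun v : V => T.degree v = 2).card := by
  classical
  have h1 := T.sum_degrees_eq_twice_card_edges
  have h2 := hT.card_edgeFinset
  -- Termwise with equality for degrees `1`, `2` and `3`; the degree sum is `2n - 2`.
  have h3 : ∑ v : V, (2 * (if 2 ≤ T.degree v then 1 else 0) + 2) ≤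
      ∑ v : V, (1 + (if T.degree v = 2 then 1 else 0) + T.degree v) := by
    refine Finset.sum_le_sum fun v _ => ?_
    have := hT.connected.preconnected.degree_pos_of_nontrivial v
    split_ifs <;> omega
  simp only [Finset.sum_add_distrib, ← Finset.mul_sum, ← Finset.card_filter, Finset.sum_const,
    Finset.card_univ, smul_eq_mul] at h3
  omega

theorem IsParent.two_le_degree {ρ : V} {par : V → V} (hp : T.IsParent ρ par) {x : V} (hx : x ≠ ρ)
    (hpx : par x ≠ ρ) : 2 ≤ T.degree (par x) := by
  classical
  have h1 := hp x hx
  have h2 := hp _ hpx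
  have hne : x ≠ par (par x) := fun h => by
    rw [← h] at h2
    omega
  rw [← card_neighborFinset_eq_degree, ← Finset.card_pair hne]
  refine Finset.card_le_card fun y hy => ?_
  rcases Finset.mem_insert.1 hy with rfl | hy
  · simpa using h1.1.symm
  · rw [Finset.mem_singleton.1 hy]
    simpa using h2.1

/-- If the order of a tree plus the number of its vertices of degree `2` is less than
`m * (m + 1)`, then its burning number is at most `m`. -/
theorem IsTree.burningNumber_le (hT : T.IsTree) (m : ℕ)
    (h : Fintype.card V + (Finset.univ.filter fun v : V => T.degree v = 2).card < m * (m + 1)) :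
    T.burningNumber ≤ m := by
  classical
  have hG := hT.connected
  have := hG.nonempty
  rcases subsingleton_or_nontrivial V with hV | hV
  · have hm : 0 < m := by
      rcases Nat.eq_zero_or_pos m with rfl | hm
      · omega
      · exact hm
    exact burningNumber_le_of_cover hG (fun _ => Classical.arbitrary V) m fun x =>
      ⟨0, hm, by rw [Subsingleton.elim (Classical.arbitrary V) x, dist_self]⟩
  have hI := hT.two_mul_card_two_le_degree_add_two_le
  obtain ⟨k, rfl⟩ : ∃ k, m = k + 2 := by
    have := Fintype.one_lt_card (α := V)
    match m, h with
    | 0, h => omega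
    | 1, h => omega
    | k + 2, _ => exact ⟨k, rfl⟩
  set I := Finset.univ.filter fun v : V => 2 ≤ T.degree v with hIdef
  obtain ⟨ρ, hρ⟩ : ∃ ρ : V, ρ ∈ I ∨ I = ∅ := by
    rcases I.eq_empty_or_nonempty with h | ⟨ρ, h⟩
    · exact ⟨Classical.arbitrary V, Or.inr h⟩
    · exact ⟨ρ, Or.inl h⟩
  obtain ⟨par, hp⟩ := hG.exists_isParent ρ
  have hpar : ∀ x, x ≠ ρ → par x ∈ insert ρ I := fun x hx => by
    by_cases hpx : par x = ρ
    · simp [hpx]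
    · simp [hIdef, hp.two_le_degree hx hpx]
  have hcard : 2 * (insert ρ I).card ≤ k * (k + 1) + 2 * (2 * k + 1) := by
    rcases hρ with hρ | hρ
    · rw [Finset.insert_eq_of_mem hρ]
      -- Parity gains the last unit: both sides of the strict bound are even.
      have he : Even (k * (k + 1)) := Nat.even_mul_succ_self k
      obtain ⟨a, ha⟩ := he
      have : (k + 2) * (k + 2 + 1) = k * (k + 1) + 4 * k + 6 := by ring
      omega
    · rw [hρ]
      simp only [insert_empty_eq, Finset.card_singleton]
      nlinarith
  obtain ⟨v, c, hvc⟩ := IsParentClosed.exists_cover hG hp k k (insert ρ I)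
    (fun x _ hx => hpar x hx) hcard
  -- Shifting indices by one turns radii `0, …, k` into `1, …, k + 1`; the ball of radius `0` is not
  -- needed.
  let c' : ℕ → V := fun i => if i = k + 1 then v else c (i - 1)
  have hcov : ∀ y ∈ insert ρ I, ∃ i < k + 2, T.dist (c' i) y + 1 ≤ i := by
    intro y hy
    rcases hvc y hy with h | ⟨i, hi, h⟩
    · exact ⟨k + 1, by omega, by simpa [c'] using h⟩
    · refine ⟨i + 1, by omega, ?_⟩
      have : i + 1 ≠ k + 1 := by omega
      simpa [c', this, show i ≠ k by omega] using h
  refine burningNumber_le_of_cover hG c' (k + 2) fun x => ?_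
  by_cases hx : x = ρ
  · obtain ⟨i, hi, h⟩ := hcov x (by simp [hx])
    exact ⟨i, hi, by omega⟩
  · obtain ⟨i, hi, h⟩ := hcov _ (hpar x hx)
    refine ⟨i, hi, ?_⟩
    have h1 := hG.dist_triangle (u := c' i) (v := par x) (w := x)
    have h2 := dist_eq_one_iff_adj.2 (hp x hx).1.symm
    omega

end Tree

end SimpleGraph

theorem mainTheorem3 {V : Type*} [Fintype V] (T : SimpleGraph V) [DecidableRel T.Adj]
    (hT : T.IsTree) (n : ℕ) (hn : Fintype.card V = n)
    (hdeg : (Finset.univ.filter (fun v : V => T.degree v = 2)).card ≤ ⌊Real.sqrt ((n : ℝ) - 1)⌋₊) :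
    T.burningNumber ≤ (⌈Real.sqrt (n : ℝ)⌉₊ : ℕ∞) := by
  have := hT.connected.nonempty
  have hpos : 0 < n := hn ▸ Fintype.card_pos
  set m := ⌈Real.sqrt (n : ℝ)⌉₊ with hm
  have hle : Real.sqrt (n : ℝ) ≤ m := Nat.le_ceil _
  have hnm : n ≤ m ^ 2 := by
    have := (Real.sqrt_le_left (Nat.cast_nonneg m)).1 hle
    exact_mod_cast this
  have hlt : ⌊Real.sqrt ((n : ℝ) - 1)⌋₊ < m := by
    rw [Nat.floor_lt (Real.sqrt_nonneg _)]
    refine lt_of_lt_of_le (Real.sqrt_lt_sqrt ?_ (sub_one_lt _)) hle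
    have : (1 : ℝ) ≤ n := by exact_mod_cast hpos
    linarith
  refine hT.burningNumber_le m ?_
  rw [hn]
  -- `n ≤ m²` and fewer than `m` vertices of degree `2` give a sum below `m² + m`.
  nlinarith
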